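/- Let $p$ be a prime number. A commutative ring $A$ of characteristic $p$ is called F-finite if its Frobenius endomorphism $A\to A$, $a\mapsto a^p$, is a finite ring homomorphism; it is called locally F-finite if the localization $A_{\mathfrak p}$ is F-finite for every prime ideal $\mathfrak p$ of $A$. (1) Let $K$ be an algebraically closed field of characteristic $2$, let $X$ be an indeterminate, and fix an algebraic closure of $K(X)$. For every $a\in K$ choose a cube root $\sqrt[3]{(X+a)^4}$ of $(X+a)^4$ in this algebraic closure, and for every $b\in K\setminus\{0\}$ choose a cube root $\sqrt[3]{b^4}$ of $b^4$ in $K$; put $\sqrt[3]{(X+a)^8}=\bigl(\sqrt[3]{(X+a)^4}\bigr)^2$ and $\sqrt[3]{b^8}=\bigl(\sqrt[3]{b^4}\bigr)^2$. Then, for all such choices, the ring $$B=K\left[X,\ \sqrt[3]{(X+a)^4},\ \frac{1}{\sqrt[3]{(X+a)^8}+\sqrt[3]{(X+a)^4}\,\sqrt[3]{b^4}+\sqrt[3]{b^8}}\ ;\ a,b\in K,\ b\neq 0\right]$$ is a one-dimensional Noetherian domain that is locally F-finite but not F-finite. (2) Consequently such examples exist in every prime characteristic: for every prime number $p$ there is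 a one-dimensional Noetherian domain of characteristic $p$ that is locally F-finite but not F-finite. -/

import Mathlib

/-- A commutative ring `A` of prime characteristic `p` is F-finite if its Frobenius endomorphism
`a ↦ a ^ p` is a finite ring homomorphism. -/
def IsFFinite (p : ℕ) [Fact p.Prime] (A : Type*) [CommRing A] [CharP A p] : Prop :=
  (frobenius A p).Finite

/-- The localization of a ring of prime characteristic `p` at a prime ideal has
characteristic `p`. -/
theorem charP_localizationAtPrime (p : ℕ) [Fact p.Prime] {A : Type*} [CommRing A] [CharP A p]
    (P : Ideal A) [P.IsPrime] : CharP (Localization.AtPrime P) p := by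
  refine (CharP.charP_iff_prime_eq_zero Fact.out).2 ?_
  rw [← map_natCast (algebraMap A (Localization.AtPrime P)) p, CharP.cast_eq_zero, map_zero]

/-- A ring of prime characteristic `p` is locally F-finite if all its localizations at prime
ideals are F-finite. -/
def IsLocallyFFinite (p : ℕ) [Fact p.Prime] (A : Type*) [CommRing A] [CharP A p] : Prop :=
  ∀ (P : Ideal A) [P.IsPrime],
    haveI : CharP (Localization.AtPrime P) p := charP_localizationAtPrime p P
    IsFFinite p (Localization.AtPrime P)

/-- The indeterminate `X` of `K(X)`, seen in an algebraic closure of `K(X)`. -/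
noncomputable def indet (K : Type*) [Field K] : AlgebraicClosure (RatFunc K) :=
  algebraMap (RatFunc K) (AlgebraicClosure (RatFunc K)) RatFunc.X

/-- The `K`-subalgebra
`K[X, t a, 1 / ((t a) ^ 2 + (t a) * (s b) + (s b) ^ 2) ; a, b ∈ K, b ≠ 0]`
of an algebraic closure of `K(X)`. Here `t a` is the chosen cube root of `(X + a) ^ 4`, and `s b`
is the chosen cube root of `b ^ 4`; their squares are the cube roots of `(X + a) ^ 8` and
`b ^ 8`. -/
noncomputable def radicalRing {K : Type*} [Field K] (t : K → AlgebraicClosure (RatFunc K))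
    (s : K → K) : Subalgebra K (AlgebraicClosure (RatFunc K)) :=
  Algebra.adjoin K
    ({indet K} ∪ Set.range t ∪
      {y | ∃ a b : K, b ≠ 0 ∧
        y = (t a ^ 2 + t a * algebraMap K (AlgebraicClosure (RatFunc K)) (s b)
          + algebraMap K (AlgebraicClosure (RatFunc K)) (s b) ^ 2)⁻¹})

/-- `radicalRing t s` contains the field `K`, hence has the same characteristic. -/
instance radicalRing.instCharP {K : Type*} [Field K] (p : ℕ) [CharP K p]
    (t : K → AlgebraicClosure (RatFunc K)) (s : K → K) : CharP (radicalRing t s) p :=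
  charP_of_injective_algebraMap (algebraMap K (radicalRing t s)).injective p

/-! Write `q = p ^ k` and let `n` be a prime dividing `q - 1`; the ring of (1) is the case `p = 2`,
`n = 3`, `q = 4`. Each `t a` puts the cusp `y ^ n = x ^ q` over `X = -a`, and the inverted sums
leave one point over each `X = -c`, with ideal `(X + c, t c)`. So every nonzero prime is maximal
with two generators, which gives Noetherianity and dimension one. Near one point all `X + a` but one
are units, and `q = n * m + 1` then makes `t a` a `q`-th power; only `X` and a single `t c` remain
as generators over the `p`-th powers. Globally there are infinitely many cusps: a homomorphism `Φ c`
to the dual numbers sends `t c` to `ε` and each other `t a` to a constant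
(`exists_algHom_dualNumber`). An element has nonzero `ε`-part for only finitely many `c`, and `p`-th
powers have none, so no finite set generates over Frobenius. `Φ c` exists because, by Kummer theory,
the `t a` satisfy only the obvious relations (`eval₂_eq_zero_of_eval₂_radical_eq_zero`). -/

/-! ### Kummer theory: linear independence of radicals -/

open Polynomial in
theorem exists_pow_eq_of_forall_algEquiv_eq {F E : Type*} [Field F] [Field E] [Algebra F E]
    [Normal F E] {n : ℕ} (hn : n.Prime) {ζ : F} (hζ : IsPrimitiveRoot ζ n) {z : E} {f : F}
    (hz : z ≠ 0) (hzf : z ^ n = algebraMap F E f) (hfix : ∀ σ : E ≃ₐ[F] E, σ z = z) :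
    ∃ g : F, g ^ n = f := by
  by_contra! hne
  have hirr : Irreducible (X ^ n - C f) := X_pow_sub_C_irreducible_of_prime hn hne
  have hmon : (X ^ n - C f).Monic := monic_X_pow_sub_C f hn.ne_zero
  have h1 : minpoly F z = X ^ n - C f :=
    (minpoly.eq_of_irreducible_of_monic hirr (by simp [hzf]) hmon).symm
  have hζn : (algebraMap F E ζ) ^ n = 1 := by rw [← map_pow, hζ.pow_eq_one, map_one]
  have h2 : minpoly F (algebraMap F E ζ * z) = X ^ n - C f :=
    (minpoly.eq_of_irreducible_of_monic hirr (by simp [mul_pow, hzf, hζn]) hmon).symm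
  have hconj : IsConjRoot F (algebraMap F E ζ * z) z := h2.trans h1.symm
  obtain ⟨σ, hσ⟩ := isConjRoot_iff_exists_algEquiv.1 hconj
  rw [hfix σ] at hσ
  have h3 : algebraMap F E ζ = 1 := (mul_eq_right₀ hz).1 hσ.symm
  exact hζ.ne_one hn.one_lt ((algebraMap F E).injective (h3.trans (map_one _).symm))

/-- `σ z / z` is an `n`-th root of unity, hence lies in `F` and is fixed by every automorphism; this
makes it multiplicative in `σ`. -/
theorem exists_kummerCharacter {F E : Type*} [Field F] [Field E] [Algebra F E] {n : ℕ}
    [NeZero n] {ζ : F} (hζ : IsPrimitiveRoot ζ n) {z : E} {f : F} (hz : z ≠ 0)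
    (hzf : z ^ n = algebraMap F E f) :
    ∃ χ : (E ≃ₐ[F] E) →* E, ∀ σ : E ≃ₐ[F] E, σ z = χ σ * z ∧ χ σ ^ n = 1 := by
  have hpow : ∀ σ : E ≃ₐ[F] E, (σ z / z) ^ n = 1 := fun σ => by
    rw [div_pow, ← map_pow, hzf, AlgEquiv.commutes, ← hzf, div_self (pow_ne_zero _ hz)]
  refine ⟨⟨⟨fun σ => σ z / z, by simp [hz]⟩, fun σ τ => ?_⟩, fun σ => ⟨by simp [hz], hpow σ⟩⟩
  obtain ⟨i, -, hi⟩ := (hζ.map_of_injective (algebraMap F E).injective).eq_pow_of_pow_eq_one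
    (hpow τ)
  have hfix : σ (τ z / z) = τ z / z := by
    rw [← hi, ← map_pow, AlgEquiv.commutes]
  have : σ (τ z) = σ z * (τ z / z) := by
    conv_rhs => rw [← hfix, ← map_mul, mul_div_cancel₀ _ hz]
  simp only [AlgEquiv.mul_apply, this]
  ring

/-- Applying all `σ` to a linear relation gives a relation between Kummer characters, so Dedekind's
theorem applies once these are distinct. Equal characters would make `z i * z j ^ (n - 1)`
Galois-invariant. -/
theorem linearIndependent_of_pow_mem {F E ι : Type*} [Field F] [Field E] [Algebra F E]
    [Normal F E] {n : ℕ} (hn : n.Prime) {ζ : F} (hζ : IsPrimitiveRoot ζ n) {z : ι → E} {f : ι → F}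
    (hz : ∀ i, z i ≠ 0) (hzf : ∀ i, z i ^ n = algebraMap F E (f i))
    (hf : ∀ i j, i ≠ j → ∀ g : F, g ^ n ≠ f i * f j ^ (n - 1)) :
    LinearIndependent F z := by
  have : NeZero n := ⟨hn.ne_zero⟩
  choose χ hχ using fun i => exists_kummerCharacter hζ (hz i) (hzf i)
  have hinj : Function.Injective χ := by
    intro i j hij
    by_contra hne
    obtain ⟨g, hg⟩ := exists_pow_eq_of_forall_algEquiv_eq hn hζ (z := z i * z j ^ (n - 1))
      (f := f i * f j ^ (n - 1)) (mul_ne_zero (hz i) (pow_ne_zero _ (hz j)))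
      (by rw [mul_pow, ← pow_mul, mul_comm (n - 1), pow_mul, hzf, hzf, map_mul, map_pow])
      (fun σ => by
        have h1 : χ j σ * χ j σ ^ (n - 1) = 1 := by
          rw [mul_pow_sub_one hn.ne_zero, (hχ j σ).2]
        rw [map_mul, map_pow, (hχ i σ).1, (hχ j σ).1, hij]
        linear_combination z i * z j ^ (n - 1) * h1)
    exact hf i j hne g hg
  have hli := (linearIndependent_monoidHom (E ≃ₐ[F] E) E).comp χ hinj
  rw [linearIndependent_iff'] at hli ⊢
  intro s g hg i hi
  have := hli s (fun i => algebraMap F E (g i) * z i) ?_ i hi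
  · simpa [hz i] using this
  · ext σ
    have := congrArg σ hg
    rw [map_sum, map_zero] at this
    rw [Finset.sum_apply, Pi.zero_apply, ← this]
    refine Finset.sum_congr rfl fun j _ => ?_
    rw [Pi.smul_apply, smul_eq_mul, Function.comp_apply, map_smul, (hχ j σ).1, Algebra.smul_def]
    ring

/-! ### Relations between the radicals -/

theorem Finsupp.prod_pow_mod_mul_prod_pow_div {ι R T : Type*} [CommRing R] [CommRing T]
    (φ : R →+* T) {n : ℕ} {w : ι → T} {h : ι → R} (hw : ∀ i, w i ^ n = φ (h i)) (m : ι →₀ ℕ) :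
    m.prod (fun i e => w i ^ e) =
      (m.mapRange (· % n) (Nat.zero_mod n)).prod (fun i e => w i ^ e) *
        φ ((m.mapRange (· / n) (Nat.zero_div n)).prod fun i e => h i ^ e) := by
  rw [Finsupp.prod_of_support_subset (s := m.support)
      (m.mapRange (· % n) _) Finsupp.support_mapRange _ (by simp),
    Finsupp.prod_of_support_subset (s := m.support)
      (m.mapRange (· / n) _) Finsupp.support_mapRange _ (by simp), map_prod,
    ← Finset.prod_mul_distrib]
  refine Finset.prod_congr rfl fun i _ => ?_
  rw [map_pow, ← hw, ← pow_mul, ← pow_add, Finsupp.mapRange_apply, Finsupp.mapRange_apply,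
    Nat.mod_add_div]

/-- The coefficient of the reduced monomial `ρ` after the `n`-th powers of the variables have been
replaced by the elements `h i` of the coefficient ring. -/
noncomputable def MvPolynomial.reducedCoeff {ι R : Type*} [CommRing R] (n : ℕ) (h : ι → R)
    (P : MvPolynomial ι R) (ρ : ι →₀ ℕ) : R :=
  open Classical in
  ∑ m ∈ P.support with m.mapRange (· % n) (Nat.zero_mod n) = ρ,
    P.coeff m * (m.mapRange (· / n) (Nat.zero_div n)).prod fun i e => h i ^ e

open Classical in
theorem MvPolynomial.eval₂_eq_sum_reducedCoeff {ι R T : Type*} [CommRing R] [CommRing T]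
    (φ : R →+* T) {n : ℕ} {w : ι → T} {h : ι → R} (hw : ∀ i, w i ^ n = φ (h i))
    (P : MvPolynomial ι R) :
    P.eval₂ φ w = ∑ ρ ∈ P.support.image (fun m => m.mapRange (· % n) (Nat.zero_mod n)),
      φ (P.reducedCoeff n h ρ) * ρ.prod fun i e => w i ^ e := by
  rw [MvPolynomial.eval₂_eq, ← Finset.sum_fiberwise_of_maps_to
    (fun m hm => Finset.mem_image_of_mem (fun m : ι →₀ ℕ => m.mapRange (· % n) (Nat.zero_mod n)) hm)]
  refine Finset.sum_congr rfl fun ρ _ => ?_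
  rw [reducedCoeff, map_sum, Finset.sum_mul]
  refine Finset.sum_congr rfl fun m hm => ?_
  have := Finsupp.prod_pow_mod_mul_prod_pow_div φ hw m
  rw [Finsupp.prod] at this
  rw [this, (Finset.mem_filter.1 hm).2, map_mul]
  ring

-- `g` is integral over `K[X]`, hence a polynomial; compare multiplicities of the root `-a`.
open Polynomial in
theorem dvd_of_pow_eq_prod_X_add_C {K : Type*} [Field K] {n q : ℕ} (hn : 0 < n) (e : K →₀ ℕ)
    {g : RatFunc K}
    (hg : g ^ n = algebraMap K[X] (RatFunc K) (e.prod fun a k => ((X + C a) ^ q) ^ k)) (a : K) :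
    n ∣ q * e a := by
  classical
  obtain ⟨y, rfl⟩ := IsIntegrallyClosed.exists_algebraMap_eq_of_isIntegral_pow (R := K[X]) hn
    (hg ▸ isIntegral_algebraMap)
  rw [← map_pow] at hg
  have hy := IsFractionRing.injective K[X] (RatFunc K) hg
  have hprod : (e.prod fun a k => ((X + C a) ^ q) ^ k) ≠ 0 :=
    Finset.prod_ne_zero_iff.2 fun b _ => pow_ne_zero _ (pow_ne_zero _ (X_add_C_ne_zero b))
  have hsplit : (e.prod fun a k => ((X + C a) ^ q) ^ k) =
      (X - C (-a)) ^ (q * e a) * (e.erase a).prod fun a k => ((X + C a) ^ q) ^ k := by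
    rw [pow_mul, C_neg, sub_neg_eq_add]
    exact (Finsupp.mul_prod_erase' e a _ (by simp)).symm
  have hroot : ((e.erase a).prod fun a k => ((X + C a) ^ q) ^ k).rootMultiplicity (-a) = 0 := by
    refine rootMultiplicity_eq_zero fun h => ?_
    rw [IsRoot, Finsupp.prod, eval_prod, Finset.prod_eq_zero_iff] at h
    obtain ⟨b, hb, hb0⟩ := h
    simp only [eval_pow, eval_add, eval_X, eval_C] at hb0
    have := eq_zero_of_pow_eq_zero (eq_zero_of_pow_eq_zero hb0)
    rw [neg_add_eq_zero] at this
    simp [this] at hb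
  have key := congrArg (rootMultiplicity (-a)) hy
  rw [hsplit] at hprod
  rw [hsplit, rootMultiplicity_mul hprod, hroot, rootMultiplicity_X_sub_C_pow,
    ← count_roots, roots_pow, Multiset.count_nsmul] at key
  exact ⟨_, key.symm⟩

open Polynomial in
theorem algebraMap_X_add_C {K : Type*} [Field K] (a : K) :
    algebraMap K[X] (AlgebraicClosure (RatFunc K)) (X + C a) =
      indet K + algebraMap K (AlgebraicClosure (RatFunc K)) a := by
  rw [indet, map_add, IsScalarTower.algebraMap_apply K[X] (RatFunc K), RatFunc.algebraMap_X,
    IsScalarTower.algebraMap_apply K K[X] (AlgebraicClosure (RatFunc K))]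
  rfl

theorem algebraMap_polynomial_injective (K : Type*) [Field K] : Function.Injective
    (algebraMap (Polynomial K) (AlgebraicClosure (RatFunc K))) := by
  rw [IsScalarTower.algebraMap_eq (Polynomial K) (RatFunc K)]
  exact (algebraMap (RatFunc K) _).injective.comp (IsFractionRing.injective _ _)

theorem indet_add_ne_zero {K : Type*} [Field K] (a : K) :
    indet K + algebraMap K (AlgebraicClosure (RatFunc K)) a ≠ 0 := by
  rw [← algebraMap_X_add_C]
  exact (map_ne_zero_iff _ (algebraMap_polynomial_injective K)).2 (Polynomial.X_add_C_ne_zero a)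

open Polynomial in
theorem linearIndepOn_reduced_monomials {K : Type*} [Field K] {n q : ℕ} (hn : n.Prime)
    (hq : n.Coprime q) {ζ : K} (hζ : IsPrimitiveRoot ζ n) {t : K → AlgebraicClosure (RatFunc K)}
    (ht : ∀ a : K, t a ^ n = (indet K + algebraMap K (AlgebraicClosure (RatFunc K)) a) ^ q) :
    LinearIndepOn (RatFunc K) (fun ρ : K →₀ ℕ => ρ.prod fun a k => t a ^ k)
      {ρ | ∀ a, ρ a < n} := by
  have ht0 : ∀ a, t a ≠ 0 := fun a h => by
    have := ht a
    rw [h, zero_pow hn.ne_zero] at this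
    exact pow_ne_zero _ (indet_add_ne_zero a) this.symm
  refine linearIndependent_of_pow_mem hn
    (hζ.map_of_injective (algebraMap K (RatFunc K)).injective)
    (f := fun ρ => algebraMap K[X] (RatFunc K) (ρ.1.prod fun a k => ((X + C a) ^ q) ^ k))
    (fun ρ => Finset.prod_ne_zero_iff.2 fun a _ => pow_ne_zero _ (ht0 a)) (fun ρ => ?_) ?_
  · rw [← IsScalarTower.algebraMap_apply]
    simp only [Finsupp.prod]
    rw [map_prod, ← Finset.prod_pow]
    refine Finset.prod_congr rfl fun a _ => ?_
    rw [map_pow, map_pow, algebraMap_X_add_C, ← ht, ← pow_mul, ← pow_mul, mul_comm]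
  · rintro ⟨ρ, hρ⟩ ⟨τ, hτ⟩ hne g hg
    refine hne (Subtype.ext (Finsupp.ext fun a => ?_))
    have hprod : (ρ.prod fun a k => ((X + C a) ^ q) ^ k) *
        (τ.prod fun a k => ((X + C a) ^ q) ^ k) ^ (n - 1) =
        (ρ + (n - 1) • τ).prod fun a k => ((X + C a) ^ q) ^ k := by
      rw [Finsupp.prod_add_index' (by simp) (by simp [pow_add]),
        Finsupp.prod_of_support_subset (s := τ.support) ((n - 1) • τ) Finsupp.support_smul _
          (by simp)]
      simp only [Finsupp.prod, ← Finset.prod_pow, ← pow_mul, Finsupp.smul_apply, smul_eq_mul,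
        mul_comm (n - 1), mul_assoc]
    rw [← map_pow, ← map_mul, hprod] at hg
    -- `n` divides `ρ a + (n - 1) * τ a`, so `ρ a ≡ τ a` mod `n`, and both are below `n`.
    have hdvd := hq.dvd_of_dvd_mul_left (dvd_of_pow_eq_prod_X_add_C hn.pos _ hg a)
    simp only [Finsupp.add_apply, Finsupp.smul_apply, smul_eq_mul] at hdvd
    have hmod : ρ a ≡ τ a [MOD n] := by
      refine Nat.ModEq.add_right_cancel' ((n - 1) * τ a) ?_
      rw [show τ a + (n - 1) * τ a = n * τ a by
        rw [add_comm, ← Nat.succ_mul, Nat.succ_eq_add_one, Nat.sub_add_cancel hn.pos]]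
      exact ((Nat.modEq_zero_iff_dvd).2 hdvd).trans
        ((Nat.modEq_zero_iff_dvd).2 (dvd_mul_right _ _)).symm
    exact hmod.eq_of_lt_of_lt (hρ a) (hτ a)

-- Reduced coefficients depend only on `P`, not on the target. Independence of the reduced monomials
-- makes them vanish in `K[X]`, hence under any `φ`.
open Polynomial in
theorem eval₂_eq_zero_of_eval₂_radical_eq_zero {K : Type*} [Field K] {n q : ℕ}
    (hn : n.Prime) (hq : n.Coprime q) {ζ : K} (hζ : IsPrimitiveRoot ζ n)
    {t : K → AlgebraicClosure (RatFunc K)}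
    (ht : ∀ a : K, t a ^ n = (indet K + algebraMap K (AlgebraicClosure (RatFunc K)) a) ^ q)
    {T : Type*} [CommRing T] (φ : K[X] →+* T) {r : K → T}
    (hr : ∀ a : K, r a ^ n = φ ((X + C a) ^ q)) {P : MvPolynomial K K[X]}
    (hP : P.eval₂ (algebraMap K[X] (AlgebraicClosure (RatFunc K))) t = 0) :
    P.eval₂ φ r = 0 := by
  classical
  rw [MvPolynomial.eval₂_eq_sum_reducedCoeff φ hr]
  rw [MvPolynomial.eval₂_eq_sum_reducedCoeff (algebraMap K[X] (AlgebraicClosure (RatFunc K)))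
    (h := fun a => (X + C a) ^ q) (fun a => by rw [map_pow, algebraMap_X_add_C, ht])] at hP
  refine Finset.sum_eq_zero fun ρ hρ => ?_
  have hli := (linearIndepOn_reduced_monomials hn hq hζ ht).mono
    (t := P.support.image fun m => m.mapRange (· % n) (Nat.zero_mod n)) ?_
  · have := linearIndepOn_finset_iff.1 hli
      (fun ρ => algebraMap K[X] (RatFunc K) (P.reducedCoeff n (fun a => (X + C a) ^ q) ρ))
      (by simpa only [Algebra.smul_def, ← IsScalarTower.algebraMap_apply] using hP) ρ hρ
    rw [(map_eq_zero_iff _ (IsFractionRing.injective K[X] (RatFunc K))).1 this, map_zero, zero_mul]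
  · intro ρ hρ a
    obtain ⟨m, -, rfl⟩ := Finset.mem_image.1 (Finset.mem_coe.1 hρ)
    exact Nat.mod_lt _ hn.pos

/-! ### Extending homomorphisms to the inverted elements -/

theorem Subalgebra.exists_algHom_extending {K E T : Type*} [Field K] [Field E] [Algebra K E]
    [CommRing T] [Algebra K T] [Nontrivial T] (A B : Subalgebra K E) (Ψ : A →ₐ[K] T)
    (hB : B ≤ Algebra.adjoin K ((A : Set E) ∪ {y | ∃ d : A, IsUnit (Ψ d) ∧ y = (d : E)⁻¹})) :
    ∃ Φ : B →ₐ[K] T, ∀ (a : A) (ha : (a : E) ∈ B), Φ ⟨a, ha⟩ = Ψ a := by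
  let S : Submonoid A := (IsUnit.submonoid T).comap Ψ
  have hS0 : ∀ d ∈ S, d ≠ 0 := by
    rintro d (hd : IsUnit (Ψ d)) rfl
    rw [map_zero] at hd
    exact not_isUnit_zero hd
  let j : Localization S →ₐ[K] E := IsLocalization.liftAlgHom (M := S) (f := A.val)
    fun d => isUnit_iff_ne_zero.2 fun h => hS0 d d.2 (Subtype.ext h)
  let Ψ' : Localization S →ₐ[K] T := IsLocalization.liftAlgHom (M := S) (f := Ψ) fun d => d.2
  have hj : ∀ a : A, j (algebraMap A _ a) = a := fun a => IsLocalization.lift_eq _ a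
  have hΨ' : ∀ a : A, Ψ' (algebraMap A _ a) = Ψ a := fun a => IsLocalization.lift_eq _ a
  have hinj : Function.Injective j := by
    rw [injective_iff_map_eq_zero]
    intro y hy
    obtain ⟨a, d, rfl⟩ := IsLocalization.exists_mk'_eq S y
    have h1 := congrArg j (IsLocalization.mk'_spec (Localization S) a d)
    rw [map_mul, hy, zero_mul, hj] at h1
    rw [show a = 0 from Subtype.ext h1.symm, IsLocalization.mk'_zero]
  have hle : B ≤ j.range := by
    refine hB.trans (Algebra.adjoin_le ?_)
    rintro y (hy | ⟨d, hd, rfl⟩)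
    · exact ⟨_, hj ⟨y, hy⟩⟩
    · refine ⟨IsLocalization.mk' _ (1 : A) (⟨d, hd⟩ : S), ?_⟩
      have h1 := congrArg j (IsLocalization.mk'_spec (Localization S) (1 : A) (⟨d, hd⟩ : S))
      rw [map_mul, hj, hj] at h1
      exact eq_inv_of_mul_eq_one_left h1
  refine ⟨Ψ'.comp ((AlgEquiv.ofInjective j hinj).symm.toAlgHom.comp (Subalgebra.inclusion hle)),
    fun a ha => ?_⟩
  rw [← hΨ']
  have hsymm : (AlgEquiv.ofInjective j hinj).symm ⟨a, hle ha⟩ = algebraMap A _ a := by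
    rw [AlgEquiv.symm_apply_eq]
    exact Subtype.ext (hj a).symm
  exact congrArg Ψ' hsymm

/-- The sum times `u - v` is `(a - b) ^ q`; if `a = b`, the sum is `n * v ^ (n - 1)`. -/
theorem Commute.sum_pow_mul_pow_ne_zero_of_pow_eq {K : Type*} [Field K] {n q : ℕ} {u v a b : K}
    (hn : (n : K) ≠ 0) (hu : u ^ n = a ^ q) (hv : v ^ n = b ^ q) (hb : b ≠ 0)
    (hab : a = b → u = v) (hsub : (a - b) ^ q = a ^ q - b ^ q) :
    ∑ i ∈ Finset.range n, u ^ i * v ^ (n - 1 - i) ≠ 0 := by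
  have hn0 : n ≠ 0 := fun h => hn (by simp [h])
  by_cases h : a = b
  · have hv0 : v ≠ 0 := fun h0 => by
      rw [h0, zero_pow hn0] at hv
      exact pow_ne_zero q hb hv.symm
    rw [hab h, geom_sum₂_self]
    exact mul_ne_zero hn (pow_ne_zero _ hv0)
  · intro h0
    have := (Commute.all u v).geom_sum₂_mul n
    rw [h0, zero_mul, hu, hv, ← hsub] at this
    exact pow_ne_zero q (sub_ne_zero.2 h) this.symm

/-! ### The cusp ring and its maps to the dual numbers -/

/-- The `K`-subalgebra of an algebraic closure of `K(X)` generated by `X`, the elements `t a`, and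
the inverses of the sums `∑ i < n, (t a) ^ i * (s b) ^ (n - 1 - i)` with `b ≠ 0`. -/
noncomputable def cuspRing {K : Type*} [Field K] (n : ℕ) (t : K → AlgebraicClosure (RatFunc K))
    (s : K → K) : Subalgebra K (AlgebraicClosure (RatFunc K)) :=
  Algebra.adjoin K
    ({indet K} ∪ Set.range t ∪
      {y | ∃ a b : K, b ≠ 0 ∧
        y = (∑ i ∈ Finset.range n,
          t a ^ i * algebraMap K (AlgebraicClosure (RatFunc K)) (s b) ^ (n - 1 - i))⁻¹})

/-- The conditions on exponents and chosen roots under which `cuspRing n t s` has exactly one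
cusp over every point of the affine line. -/
structure IsCuspData {K : Type*} [Field K] (p n k : ℕ) (t : K → AlgebraicClosure (RatFunc K))
    (s : K → K) : Prop where
  prime : n.Prime
  ne_zero : k ≠ 0
  dvd : n ∣ p ^ k - 1
  pow_t : ∀ a : K, t a ^ n = (indet K + algebraMap K (AlgebraicClosure (RatFunc K)) a) ^ p ^ k
  pow_s : ∀ b : K, b ≠ 0 → s b ^ n = b ^ p ^ k

namespace IsCuspData

variable {K : Type*} [Field K] {p n k : ℕ} [Fact p.Prime]
  {t : K → AlgebraicClosure (RatFunc K)} {s : K → K}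

theorem coprime (h : IsCuspData p n k t s) : n.Coprime (p ^ k) := by
  rw [h.prime.coprime_iff_not_dvd]
  intro hd
  have h1 : 1 ≤ p ^ k := Nat.one_le_pow _ _ (Fact.out : p.Prime).pos
  have := (Nat.dvd_sub_iff_right h1 hd).1 h.dvd
  exact h.prime.one_lt.ne' (Nat.dvd_one.1 this)

theorem natCast_ne_zero [CharP K p] (h : IsCuspData p n k t s) : (n : K) ≠ 0 := by
  rw [Ne, CharP.cast_eq_zero_iff K p]
  intro hd
  have := (Nat.coprime_primes Fact.out h.prime).1
    ((Nat.coprime_pow_right_iff (Nat.pos_of_ne_zero h.ne_zero) _ _).1 h.coprime).symm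
  exact this ((Nat.prime_dvd_prime_iff_eq Fact.out h.prime).1 hd)

theorem exists_algHom_dualNumber [CharP K p] [IsAlgClosed K] (h : IsCuspData p n k t s) (c : K) :
    ∃ Φ : cuspRing n t s →ₐ[K] DualNumber K,
      (∀ hx : indet K ∈ cuspRing n t s, Φ ⟨_, hx⟩ = algebraMap K (DualNumber K) (-c)) ∧
      (∀ ht : t c ∈ cuspRing n t s, Φ ⟨_, ht⟩ = DualNumber.eps) ∧
      ∀ (a : K) (ht : t a ∈ cuspRing n t s), a ≠ c →
        Φ ⟨_, ht⟩ = algebraMap K (DualNumber K) (s (a - c)) := by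
  classical
  have : NeZero (n : K) := ⟨h.natCast_ne_zero⟩
  obtain ⟨ζ, hζ⟩ := HasEnoughRootsOfUnity.exists_primitiveRoot K n
  let φ : Polynomial K →ₐ[K] DualNumber K :=
    Polynomial.aeval (algebraMap K (DualNumber K) (-c))
  let r : K → DualNumber K := fun a =>
    if a = c then DualNumber.eps else algebraMap K (DualNumber K) (s (a - c))
  have hpk : 2 ≤ p ^ k := (Nat.one_lt_pow h.ne_zero (Fact.out : p.Prime).one_lt)
  have heps : ∀ m : ℕ, 2 ≤ m → (DualNumber.eps : DualNumber K) ^ m = 0 := fun m hm =>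
    pow_eq_zero_of_le hm (by rw [pow_two, DualNumber.eps_mul_eps])
  have hr : ∀ a : K, r a ^ n = φ ((Polynomial.X + Polynomial.C a) ^ p ^ k) := by
    intro a
    rw [map_pow, map_add, Polynomial.aeval_X, Polynomial.aeval_C, ← map_add, ← map_pow]
    by_cases hac : a = c
    -- At the cusp itself both sides vanish: `ε ^ n = 0` and `X + c ↦ 0`.
    · simp only [r, if_pos hac]
      rw [heps n h.prime.two_le, hac, neg_add_cancel, zero_pow (by omega), map_zero]
    · simp only [r, if_neg hac]
      rw [← map_pow, h.pow_s _ (sub_ne_zero.2 hac), neg_add_eq_sub]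
  let f : MvPolynomial K (Polynomial K) →ₐ[K] AlgebraicClosure (RatFunc K) :=
    (MvPolynomial.aeval t).restrictScalars K
  let g : MvPolynomial K (Polynomial K) →ₐ[K] DualNumber K :=
    { MvPolynomial.eval₂Hom (φ : Polynomial K →+* DualNumber K) r with
      commutes' := fun a => by
        change MvPolynomial.eval₂Hom _ _ (MvPolynomial.C (Polynomial.C a)) = _
        rw [MvPolynomial.eval₂Hom_C]
        exact φ.commutes a }
  have hker : RingHom.ker f.rangeRestrict ≤ RingHom.ker g := fun P hP =>
    eval₂_eq_zero_of_eval₂_radical_eq_zero h.prime h.coprime hζ h.pow_t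
      (φ : Polynomial K →+* DualNumber K) hr (congrArg Subtype.val hP)
  let Ψ : f.range →ₐ[K] DualNumber K :=
    AlgHom.liftOfSurjective f.rangeRestrict f.rangeRestrict_surjective g hker
  have hΨ : ∀ P, Ψ (f.rangeRestrict P) = g P := AlgHom.liftOfSurjective_apply _ _ _ _
  have hX : f (MvPolynomial.C Polynomial.X) = indet K := by
    change MvPolynomial.aeval t _ = _
    rw [MvPolynomial.aeval_C]
    simpa using algebraMap_X_add_C (0 : K)
  have ht : ∀ a, f (MvPolynomial.X a) = t a := fun a => MvPolynomial.aeval_X t a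
  have hgX : g (MvPolynomial.C Polynomial.X) = algebraMap K (DualNumber K) (-c) :=
    (MvPolynomial.eval₂Hom_C _ _ _).trans (Polynomial.aeval_X _)
  have hg : ∀ a, g (MvPolynomial.X a) = r a := fun a => MvPolynomial.eval₂Hom_X' _ _ _
  obtain ⟨Φ, hΦ⟩ := Subalgebra.exists_algHom_extending f.range (cuspRing n t s) Ψ <| by
    refine Algebra.adjoin_le ?_
    rintro y ((rfl | ⟨a, rfl⟩) | ⟨a, b, hb, rfl⟩)
    · exact Algebra.subset_adjoin (Or.inl ⟨_, hX⟩)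
    · exact Algebra.subset_adjoin (Or.inl ⟨_, ht a⟩)
    · let d : MvPolynomial K (Polynomial K) := ∑ i ∈ Finset.range n,
        MvPolynomial.X a ^ i * algebraMap K _ (s b) ^ (n - 1 - i)
      refine Algebra.subset_adjoin (Or.inr ⟨f.rangeRestrict d, ?_, ?_⟩)
      -- A dual number is a unit once its constant part is nonzero, so only values at the point `X =
      -- -c` matter.
      · rw [hΨ, TrivSqZeroExt.isUnit_iff_isUnit_fst, isUnit_iff_ne_zero]
        have hfst : (g d).fst = ∑ i ∈ Finset.range n, (r a).fst ^ i * s b ^ (n - 1 - i) := by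
          simp only [d, map_sum, map_mul, map_pow, hg, AlgHom.commutes]
          rw [TrivSqZeroExt.fst_sum]
          simp [TrivSqZeroExt.algebraMap_eq_inl]
        rw [hfst]
        refine Commute.sum_pow_mul_pow_ne_zero_of_pow_eq h.natCast_ne_zero (a := a - c) ?_
          (h.pow_s b hb) hb ?_ (sub_pow_char_pow ..)
        · by_cases hac : a = c
          · simp [r, hac, h.prime.ne_zero, (Fact.out : p.Prime).ne_zero]
          · simp [r, hac, TrivSqZeroExt.algebraMap_eq_inl, h.pow_s _ (sub_ne_zero.2 hac)]
        · rintro rfl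
          simp [r, sub_ne_zero.1 hb, TrivSqZeroExt.algebraMap_eq_inl]
      · change _ = (f d)⁻¹
        simp only [d, map_sum, map_mul, map_pow, ht, AlgHom.commutes]
  refine ⟨Φ, fun hx => ?_, fun htc => ?_, fun a hta hac => ?_⟩
  · have := hΦ (f.rangeRestrict (MvPolynomial.C Polynomial.X)) (by simpa [hX] using hx)
    rw [hΨ, hgX] at this
    rw [← this]
    exact congrArg Φ (Subtype.ext hX.symm)
  · have := hΦ (f.rangeRestrict (MvPolynomial.X c)) (by simpa [ht] using htc)
    rw [hΨ, hg] at this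
    rw [show (DualNumber.eps : DualNumber K) = r c by simp [r], ← this]
    exact congrArg Φ (Subtype.ext (ht c).symm)
  · have := hΦ (f.rangeRestrict (MvPolynomial.X a)) (by simpa [ht] using hta)
    rw [hΨ, hg] at this
    rw [show algebraMap K (DualNumber K) (s (a - c)) = r a by simp [r, hac], ← this]
    exact congrArg Φ (Subtype.ext (ht a).symm)

end IsCuspData

/-! ### Prime ideals, Noetherianity and dimension -/

namespace cuspRing

variable {K : Type*} [Field K] (n : ℕ) (t : K → AlgebraicClosure (RatFunc K)) (s : K → K)

/-- The indeterminate as an element of `cuspRing n t s`. -/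
noncomputable def X : cuspRing n t s :=
  ⟨indet K, Algebra.subset_adjoin (Or.inl (Or.inl rfl))⟩

/-- The chosen radical `t a` as an element of `cuspRing n t s`. -/
noncomputable def root (a : K) : cuspRing n t s :=
  ⟨t a, Algebra.subset_adjoin (Or.inl (Or.inr ⟨a, rfl⟩))⟩

/-- The denominator at `a, b` as an element of `cuspRing n t s`. -/
noncomputable def denom (a b : K) : cuspRing n t s :=
  ∑ i ∈ Finset.range n, root n t s a ^ i * algebraMap K (cuspRing n t s) (s b) ^ (n - 1 - i)

theorem coe_denom (a b : K) : (denom n t s a b : AlgebraicClosure (RatFunc K)) =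
    ∑ i ∈ Finset.range n,
      t a ^ i * algebraMap K (AlgebraicClosure (RatFunc K)) (s b) ^ (n - 1 - i) := by
  change (cuspRing n t s).val _ = _
  simp only [denom, map_sum, map_mul, map_pow, AlgHom.commutes]
  rfl

end cuspRing

namespace IsCuspData

open cuspRing

variable {K : Type*} [Field K] {p n k : ℕ}
  {t : K → AlgebraicClosure (RatFunc K)} {s : K → K}

theorem root_pow (h : IsCuspData p n k t s) (a : K) :
    root n t s a ^ n = (X n t s + algebraMap K _ a) ^ p ^ k :=
  Subtype.ext (h.pow_t a)

theorem denom_mul_root_sub [Fact p.Prime] [CharP K p] (h : IsCuspData p n k t s) (a : K) {b : K} (hb : b ≠ 0) :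
    denom n t s a b * (root n t s a - algebraMap K _ (s b)) =
      (X n t s + algebraMap K _ (a - b)) ^ p ^ k := by
  have : CharP (cuspRing n t s) p :=
    charP_of_injective_algebraMap (algebraMap K (cuspRing n t s)).injective p
  rw [denom, (Commute.all _ _).geom_sum₂_mul, h.root_pow, ← map_pow, h.pow_s b hb, map_pow,
    ← sub_pow_char_pow, map_sub, add_sub_assoc]

theorem X_add_ne_zero (a : K) : X n t s + algebraMap K _ a ≠ 0 := fun h0 =>
  indet_add_ne_zero a (congrArg Subtype.val h0)

theorem exists_denom_mul_eq_one [Fact p.Prime] [CharP K p] (h : IsCuspData p n k t s) (a : K) {b : K}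
    (hb : b ≠ 0) : ∃ z : cuspRing n t s, denom n t s a b * z = 1 ∧
      (z : AlgebraicClosure (RatFunc K)) = (∑ i ∈ Finset.range n,
        t a ^ i * algebraMap K (AlgebraicClosure (RatFunc K)) (s b) ^ (n - 1 - i))⁻¹ := by
  refine ⟨⟨_, Algebra.subset_adjoin (Or.inr ⟨a, b, hb, rfl⟩)⟩, Subtype.ext ?_, rfl⟩
  have h0 : (denom n t s a b : AlgebraicClosure (RatFunc K)) ≠ 0 := fun h0 => by
    have h1 := h.denom_mul_root_sub a hb
    rw [show denom n t s a b = 0 from Subtype.ext h0, zero_mul] at h1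
    exact pow_ne_zero _ (X_add_ne_zero _) h1.symm
  change (denom n t s a b : AlgebraicClosure (RatFunc K)) * _ = 1
  rw [coe_denom] at h0 ⊢
  exact mul_inv_cancel₀ h0

-- Replacing the inverted generators by closure under all existing inverses spares later inductions
-- any computation with the denominators.
@[elab_as_elim]
theorem induction [Fact p.Prime] [CharP K p] (h : IsCuspData p n k t s) {motive : cuspRing n t s → Prop}
    (algebraMap : ∀ r, motive (algebraMap K _ r)) (X : motive (X n t s))
    (root : ∀ a, motive (root n t s a)) (add : ∀ y z, motive y → motive z → motive (y + z))
    (mul : ∀ y z, motive y → motive z → motive (y * z))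
    (inv : ∀ y z, y * z = 1 → motive y → motive z) (y : cuspRing n t s) : motive y := by
  let M : Subalgebra K (cuspRing n t s) :=
    { carrier := {y | motive y}
      mul_mem' := fun hy hz => mul _ _ hy hz
      add_mem' := fun hy hz => add _ _ hy hz
      algebraMap_mem' := algebraMap }
  suffices hle : cuspRing n t s ≤ M.map (cuspRing n t s).val by
    obtain ⟨z, hz, hzy⟩ := hle y.2
    rwa [← Subtype.ext (a1 := z) (a2 := y) hzy]
  refine Algebra.adjoin_le ?_
  rintro y ((rfl | ⟨a, rfl⟩) | ⟨a, b, hb, rfl⟩)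
  · exact ⟨_, X, rfl⟩
  · exact ⟨_, root a, rfl⟩
  · obtain ⟨z, hz, hz'⟩ := h.exists_denom_mul_eq_one a hb
    refine ⟨z, inv _ _ hz ?_, hz'⟩
    change denom n t s a b ∈ M
    exact sum_mem fun i _ => mul_mem (pow_mem (root a) _) (pow_mem (algebraMap _) _)

theorem exists_sub_algebraMap_mem [Fact p.Prime] [CharP K p] (h : IsCuspData p n k t s) (c : K)
    (hc : Ideal.span {X n t s + algebraMap K _ c, root n t s c} ≠ ⊤) (y : cuspRing n t s) :
    ∃ a : K, y - algebraMap K _ a ∈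
      Ideal.span {X n t s + algebraMap K _ c, root n t s c} := by
  set Q := Ideal.span {X n t s + algebraMap K _ c, root n t s c} with hQ
  have hX : X n t s + algebraMap K _ c ∈ Q := Ideal.subset_span (by simp)
  induction y using h.induction with
  | algebraMap r => exact ⟨r, by simp⟩
  | X => exact ⟨-c, by rwa [map_neg, sub_neg_eq_add]⟩
  | root a =>
    by_cases hac : a = c
    · exact ⟨0, by rw [hac, map_zero, sub_zero]; exact Ideal.subset_span (by simp)⟩
    · have hb : a - c ≠ 0 := sub_ne_zero.2 hac
      -- With `b = a - c` the factorization reads `denom * (t a - s b) = (X + c) ^ q`, and the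
      -- denominator is a unit.
      refine ⟨s (a - c), ?_⟩
      obtain ⟨z, hz, -⟩ := h.exists_denom_mul_eq_one a hb
      have h1 := h.denom_mul_root_sub a hb
      rw [sub_sub_cancel] at h1
      have h2 : root n t s a - algebraMap K _ (s (a - c)) =
          z * (X n t s + algebraMap K _ c) ^ p ^ k := by
        linear_combination -(root n t s a - algebraMap K _ (s (a - c))) * hz + z * h1
      rw [h2]
      exact Q.mul_mem_left _ (Q.pow_mem_of_mem hX _ (pow_pos (Fact.out : p.Prime).pos k))
  | add y z hy hz =>
    obtain ⟨a, ha⟩ := hy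
    obtain ⟨b, hb⟩ := hz
    exact ⟨a + b, by rw [map_add, add_sub_add_comm]; exact add_mem ha hb⟩
  | mul y z hy hz =>
    obtain ⟨a, ha⟩ := hy
    obtain ⟨b, hb⟩ := hz
    refine ⟨a * b, ?_⟩
    rw [map_mul, show y * z - algebraMap K _ a * algebraMap K _ b =
      z * (y - algebraMap K _ a) + algebraMap K _ a * (z - algebraMap K _ b) by ring]
    exact add_mem (Q.mul_mem_left _ ha) (Q.mul_mem_left _ hb)
  | inv y z hyz hy =>
    obtain ⟨a, ha⟩ := hy
    have ha0 : a ≠ 0 := by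
      rintro rfl
      rw [map_zero, sub_zero] at ha
      exact hc ((Ideal.eq_top_iff_one _).2 (hyz ▸ Q.mul_mem_right z ha))
    refine ⟨a⁻¹, ?_⟩
    have h1 : algebraMap K (cuspRing n t s) a * algebraMap K _ a⁻¹ = 1 := by
      rw [← map_mul, mul_inv_cancel₀ ha0, map_one]
    rw [show z - algebraMap K (cuspRing n t s) a⁻¹ =
      (-z * algebraMap K _ a⁻¹) * (y - algebraMap K _ a) by
        linear_combination algebraMap K (cuspRing n t s) a⁻¹ * hyz - z * h1]
    exact Q.mul_mem_left _ ha

/-- A nonzero element of `P` is algebraic over `K[X]`, so `P` meets `K[X]` nontrivially; a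
polynomial there splits, and `P` is prime. -/
theorem exists_X_add_mem [IsAlgClosed K] {P : Ideal (cuspRing n t s)}
    (hP : P.IsPrime) (hP0 : P ≠ ⊥) : ∃ c : K, X n t s + algebraMap K _ c ∈ P := by
  obtain ⟨y, hyP, hy0⟩ := Submodule.exists_mem_ne_zero_of_ne_bot hP0
  let f : Polynomial K →+* cuspRing n t s := (Polynomial.aeval (X n t s) : Polynomial K →ₐ[K] _)
  have hf : (cuspRing n t s).val.toRingHom.comp f =
      algebraMap (Polynomial K) (AlgebraicClosure (RatFunc K)) := by
    refine Polynomial.ringHom_ext (fun a => ?_) ?_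
    · simp only [f, RingHom.comp_apply, RingHom.coe_coe, Polynomial.aeval_C]
      exact IsScalarTower.algebraMap_apply K (Polynomial K) _ a
    · simp only [f, RingHom.comp_apply, RingHom.coe_coe, Polynomial.aeval_X]
      change indet K = _
      simpa using (algebraMap_X_add_C (0 : K)).symm
  obtain ⟨g, hg0, hg⟩ : IsAlgebraic (Polynomial K) (y : AlgebraicClosure (RatFunc K)) :=
    (IsFractionRing.isAlgebraic_iff (Polynomial K) (RatFunc K) _).2
      (Algebra.IsAlgebraic.isAlgebraic _)
  have hroot : g.eval₂ f y = 0 := by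
    refine Subtype.ext ?_
    change (cuspRing n t s).val.toRingHom _ = 0
    rw [Polynomial.hom_eval₂, hf]
    exact hg
  obtain ⟨q, hqP, hq0⟩ := Submodule.exists_mem_ne_zero_of_ne_bot
    (Ideal.comap_ne_bot_of_root_mem hy0 hyP hg0 hroot)
  have hprime : (P.comap f).IsPrime := Ideal.comap_isPrime f P
  rw [(IsAlgClosed.splits q).eq_prod_roots] at hqP
  rcases hprime.mem_or_mem hqP with hC | hprod
  · refine absurd (Ideal.eq_top_of_isUnit_mem _ hC ?_) hprime.ne_top
    exact Polynomial.isUnit_C.2 (isUnit_iff_ne_zero.2 (Polynomial.leadingCoeff_ne_zero.2 hq0))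
  · obtain ⟨r, hr, hrP⟩ := (hprime.multiset_prod_mem_iff_exists_mem _).1 hprod
    obtain ⟨c, -, rfl⟩ := Multiset.mem_map.1 hr
    refine ⟨-c, ?_⟩
    have : f (Polynomial.X - Polynomial.C c) ∈ P := hrP
    simpa [f, sub_eq_add_neg] using this

/-- Modulo `(X + c, t c)` every element is a constant, and a nonzero constant lies in no proper
ideal. -/
theorem exists_eq_span_of_isPrime [Fact p.Prime] [CharP K p] [IsAlgClosed K] (h : IsCuspData p n k t s)
    {P : Ideal (cuspRing n t s)} (hP : P.IsPrime) (hP0 : P ≠ ⊥) :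
    ∃ c : K, P = Ideal.span {X n t s + algebraMap K _ c, root n t s c} ∧ P.IsMaximal := by
  obtain ⟨c, hc⟩ := exists_X_add_mem hP hP0
  have hroot : root n t s c ∈ P := hP.mem_of_pow_mem n <| by
    rw [h.root_pow]
    exact P.pow_mem_of_mem hc _ (pow_pos (Fact.out : p.Prime).pos k)
  have hle : Ideal.span {X n t s + algebraMap K _ c, root n t s c} ≤ P :=
    Ideal.span_le.2 (Set.insert_subset hc (Set.singleton_subset_iff.2 hroot))
  have hres := h.exists_sub_algebraMap_mem c (ne_top_of_le_ne_top hP.ne_top hle)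
  have hunit : ∀ (I : Ideal (cuspRing n t s)) {a : K}, a ≠ 0 → algebraMap K _ a ∈ I → I = ⊤ :=
    fun I a ha hI => I.eq_top_of_isUnit_mem hI ((isUnit_iff_ne_zero.2 ha).map _)
  refine ⟨c, le_antisymm (fun y hy => ?_) hle, Ideal.isMaximal_def.2 ⟨hP.ne_top, fun J hJ => ?_⟩⟩
  · obtain ⟨a, ha⟩ := hres y
    have ha0 : a = 0 := by
      by_contra ha0
      exact hP.ne_top (hunit P ha0 ((Submodule.sub_mem_iff_right P hy).1 (hle ha)))
    simpa [ha0] using ha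
  · obtain ⟨y, hyJ, hyP⟩ := Set.exists_of_ssubset hJ
    obtain ⟨a, ha⟩ := hres y
    have ha0 : a ≠ 0 := by
      rintro rfl
      exact hyP (hle (by simpa using ha))
    exact hunit J ha0 ((Submodule.sub_mem_iff_right J hyJ).1 (hJ.le (hle ha)))

theorem isNoetherianRing [Fact p.Prime] [CharP K p] [IsAlgClosed K] (h : IsCuspData p n k t s) :
    IsNoetherianRing (cuspRing n t s) :=
  IsNoetherianRing.of_prime_ne_bot fun P hP hP0 => by
    obtain ⟨c, hc, -⟩ := h.exists_eq_span_of_isPrime hP hP0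
    exact hc ▸ Submodule.fg_span (Set.toFinite _)

theorem not_isField [Fact p.Prime] [CharP K p] [IsAlgClosed K] (h : IsCuspData p n k t s) :
    ¬ IsField (cuspRing n t s) := by
  intro hfield
  obtain ⟨Φ, -, hΦ, -⟩ := h.exists_algHom_dualNumber 0
  have hne : root n t s 0 ≠ 0 := fun h0 => by
    have := h.root_pow 0
    rw [h0, zero_pow h.prime.ne_zero] at this
    exact pow_ne_zero _ (X_add_ne_zero _) this.symm
  obtain ⟨z, hz⟩ := hfield.mul_inv_cancel hne
  have := congrArg (fun y => (Φ y).fst) hz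
  rw [map_mul, show Φ (root n t s 0) = DualNumber.eps from hΦ _] at this
  simp at this

theorem ringKrullDim_eq_one [Fact p.Prime] [CharP K p] [IsAlgClosed K] (h : IsCuspData p n k t s) :
    ringKrullDim (cuspRing n t s) = 1 := by
  refine eq_of_le_of_not_lt ?_ fun hlt => h.not_isField ?_
  · rw [← Nat.cast_one, ← Ring.krullDimLE_iff, Ring.krullDimLE_one_iff_of_noZeroDivisors]
    intro P hP0 hP
    exact (h.exists_eq_span_of_isPrime hP hP0).choose_spec.2
  · have hle : ringKrullDim (cuspRing n t s) ≤ 0 := Order.le_of_lt_succ hlt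
    rw [← Nat.cast_zero, ← Ring.krullDimLE_iff] at hle
    exact Ring.KrullDimLE.isField_of_isDomain

end IsCuspData

/-! ### Finiteness of Frobenius, locally and globally -/

theorem RingHom.finite_of_closure_eq_top {R A : Type*} [CommRing R] [CommRing A] (f : R →+* A)
    {S : Set A} (hS : S.Finite) (hint : ∀ x ∈ S, f.IsIntegralElem x)
    (hgen : Subring.closure (Set.range f ∪ S) = ⊤) : f.Finite := by
  algebraize [f]
  have htop : Algebra.adjoin R S = ⊤ := by
    refine Algebra.eq_top_iff.2 fun x => ?_
    have hle : Subring.closure (Set.range f ∪ S) ≤ (Algebra.adjoin R S).toSubring :=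
      Subring.closure_le.2 (Set.union_subset
        (by rintro _ ⟨r, rfl⟩; exact (Algebra.adjoin R S).algebraMap_mem r)
        Algebra.subset_adjoin)
    exact hle (hgen ▸ Subring.mem_top x)
  have hfg := fg_adjoin_of_finite hS hint
  rw [htop, Algebra.top_toSubmodule] at hfg
  exact ⟨hfg⟩

theorem RingHom.Finite.exists_finset_eq_sum {R A : Type*} [CommRing R] [CommRing A] {f : R →+* A}
    (hf : f.Finite) : ∃ S : Finset A, ∀ y, ∃ c : A → R, y = ∑ x ∈ S, f (c x) * x := by
  algebraize [f]
  obtain ⟨S, hS⟩ := (inferInstance : Module.Finite R A).fg_top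
  refine ⟨S, fun y => ?_⟩
  obtain ⟨c, -, hc⟩ := Submodule.mem_span_finset.1 (hS ▸ Submodule.mem_top (x := y))
  exact ⟨c, hc.symm⟩

namespace IsCuspData

open cuspRing

variable {K : Type*} [Field K] {p n k : ℕ} [Fact p.Prime] [CharP K p] [IsAlgClosed K]
  {t : K → AlgebraicClosure (RatFunc K)} {s : K → K}

theorem isLocallyFFinite [CharP (cuspRing n t s) p] (h : IsCuspData p n k t s) :
    IsLocallyFFinite p (cuspRing n t s) := by
  intro P hP
  have : CharP (Localization.AtPrime P) p := charP_localizationAtPrime p P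
  have hp : p ≠ 0 := (Fact.out : p.Prime).ne_zero
  have hpred : p - 1 + 1 = p := Nat.sub_add_cancel (Fact.out : p.Prime).pos
  -- Two elements `X + a`, `X + b` of `P` would differ by a unit.
  obtain ⟨c, hc⟩ : ∃ c : K, ∀ a, a ≠ c → X n t s + algebraMap K _ a ∉ P := by
    by_contra! hcon
    obtain ⟨a, -, ha⟩ := hcon 0
    obtain ⟨b, hba, hb⟩ := hcon a
    have hsub := P.sub_mem hb ha
    rw [add_sub_add_left_eq_sub, ← map_sub] at hsub
    exact hP.ne_top (P.eq_top_of_isUnit_mem hsub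
      ((isUnit_iff_ne_zero.2 (sub_ne_zero.2 hba)).map _))
  let ι := algebraMap (cuspRing n t s) (Localization.AtPrime P)
  let C := Subring.closure (Set.range (frobenius (Localization.AtPrime P) p) ∪
    {ι (X n t s), ι (root n t s c)})
  have hfrob : ∀ y, y ^ p ∈ C := fun y => Subring.subset_closure (Or.inl ⟨y, rfl⟩)
  have hB : ∀ y, ι y ∈ C := by
    intro y
    induction y using h.induction with
    | algebraMap r =>
      obtain ⟨r', rfl⟩ := IsAlgClosed.exists_pow_nat_eq r (Fact.out : p.Prime).pos
      rw [map_pow, map_pow]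
      exact hfrob _
    | X => exact Subring.subset_closure (by simp)
    | root a =>
      by_cases hac : a = c
      · exact Subring.subset_closure (by simp [hac])
      · obtain ⟨v, hv⟩ := (IsLocalization.map_units (Localization.AtPrime P)
          (⟨_, hc a hac⟩ : P.primeCompl)).exists_right_inv
        change ι (X n t s + algebraMap K _ a) * v = 1 at hv
        obtain ⟨m, hm⟩ := h.dvd
        have hq : p ^ k = n * m + 1 := by
          have := Nat.one_le_pow k p (Fact.out : p.Prime).pos
          omega
        -- `t a ^ q = t a * (t a ^ n) ^ m = t a * (X + a) ^ (q * m)`, and `v` inverts `X + a`.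
        have hpow : ι (root n t s a) = (ι (root n t s a) * v ^ m) ^ p ^ k := by
          have h1 : ι (root n t s a) ^ p ^ k =
              ι (root n t s a) * ι (X n t s + algebraMap K _ a) ^ (p ^ k * m) := by
            rw [pow_mul, ← map_pow, ← map_pow, ← h.root_pow, ← map_pow, ← map_mul, ← pow_mul, hq,
              pow_succ']
          rw [mul_pow, h1, ← pow_mul, mul_comm m, mul_assoc, ← mul_pow, hv, one_pow, mul_one]
        rw [hpow, ← Nat.sub_add_cancel (Nat.pos_of_ne_zero h.ne_zero), pow_succ, pow_mul]
        exact hfrob _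
    | add y z hy hz => rw [map_add]; exact add_mem hy hz
    | mul y z hy hz => rw [map_mul]; exact mul_mem hy hz
    | inv y z hyz hy =>
      have : z = y ^ (p - 1) * z ^ p := by
        conv_rhs => rw [← hpred, pow_succ, Nat.add_sub_cancel, ← mul_assoc, ← mul_pow, hyz,
          one_pow, one_mul]
      rw [this, map_mul, map_pow, map_pow]
      exact mul_mem (pow_mem hy _) (hfrob _)
  refine RingHom.finite_of_closure_eq_top _ (S := {ι (X n t s), ι (root n t s c)})
    (Set.toFinite _) (fun x _ => ⟨Polynomial.X ^ p - Polynomial.C x,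
      Polynomial.monic_X_pow_sub_C x hp, by simp [frobenius_def]⟩)
    (eq_top_iff.2 fun w _ => ?_)
  obtain ⟨y, z, rfl⟩ := IsLocalization.exists_mk'_eq P.primeCompl w
  have hz := IsLocalization.mk'_spec (Localization.AtPrime P) (1 : cuspRing n t s) z
  rw [map_one] at hz
  have hinv : IsLocalization.mk' (Localization.AtPrime P) (1 : cuspRing n t s) z =
      ι z ^ (p - 1) * IsLocalization.mk' (Localization.AtPrime P) (1 : cuspRing n t s) z ^ p := by
    conv_rhs => rw [← hpred, pow_succ, Nat.add_sub_cancel, ← mul_assoc, ← mul_pow, mul_comm (ι _),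
      hz, one_pow, one_mul]
  rw [IsLocalization.mk'_eq_mul_mk'_one, hinv]
  exact mul_mem (hB y) (mul_mem (pow_mem (hB z) _) (hfrob _))

theorem not_isFFinite [CharP (cuspRing n t s) p] (h : IsCuspData p n k t s) :
    ¬ IsFFinite p (cuspRing n t s) := by
  intro hfin
  obtain ⟨S, hS⟩ := RingHom.Finite.exists_finset_eq_sum hfin
  choose Φ hX heps hroot using h.exists_algHom_dualNumber
  have hB : ∀ y : cuspRing n t s, {c | (Φ c y).snd ≠ 0}.Finite := by
    intro y
    induction y using h.induction with
    | algebraMap r => simp [TrivSqZeroExt.algebraMap_eq_inl]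
    | X => simp [show ∀ c, Φ c (X n t s) = _ from fun c => hX c _, TrivSqZeroExt.algebraMap_eq_inl]
    | root a =>
      refine (Set.finite_singleton a).subset fun c hc => ?_
      by_contra hac
      refine hc ?_
      rw [show Φ c (root n t s a) = _ from hroot c a _ (Ne.symm hac),
        TrivSqZeroExt.algebraMap_eq_inl, TrivSqZeroExt.snd_inl]
    | add y z hy hz =>
      refine (hy.union hz).subset fun c hc => ?_
      by_contra hcon
      simp only [Set.mem_union, Set.mem_ofPred_eq, not_or, not_not] at hcon
      exact hc (by simp [hcon])
    | mul y z hy hz =>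
      refine (hy.union hz).subset fun c hc => ?_
      by_contra hcon
      simp only [Set.mem_union, Set.mem_ofPred_eq, not_or, not_not] at hcon
      exact hc (by simp [hcon])
    | inv y z hyz hy =>
      refine hy.subset fun c hc hy0 => hc ?_
      have h1 := congrArg (Φ c) hyz
      rw [map_mul, map_one] at h1
      have h2 : (Φ c y).fst * (Φ c z).fst = 1 := by simpa using congrArg TrivSqZeroExt.fst h1
      have h3 := congrArg TrivSqZeroExt.snd h1
      rw [TrivSqZeroExt.snd_mul, hy0, smul_zero, add_zero, TrivSqZeroExt.snd_one,
        smul_eq_mul] at h3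
      exact (mul_eq_zero.1 h3).resolve_left (left_ne_zero_of_mul_eq_one h2)
  -- `K` is infinite, so some cusp avoids the finitely many detected by the generators.
  obtain ⟨c, hc⟩ := (S.finite_toSet.biUnion fun y _ => hB y).exists_notMem
  have hc : ∀ y ∈ S, (Φ c y).snd = 0 := fun y hy => by_contra fun h0 =>
    hc (Set.mem_biUnion (Finset.mem_coe.2 hy) h0)
  obtain ⟨g, hg⟩ := hS (root n t s c)
  have h1 := congrArg (fun y => (Φ c y).snd) hg
  simp only [map_sum, map_mul, frobenius_def, map_pow] at h1
  rw [show Φ c (root n t s c) = _ from heps c _, DualNumber.snd_eps, TrivSqZeroExt.snd_sum,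
    Finset.sum_eq_zero] at h1
  · exact one_ne_zero h1
  · intro y hy
    -- The `ε`-part of a `p`-th power carries the factor `p = 0`.
    rw [TrivSqZeroExt.snd_mul, hc y hy, TrivSqZeroExt.snd_pow]
    simp [← Nat.cast_smul_eq_nsmul K]

end IsCuspData

/-! ### Choice of exponents -/

theorem radicalRing_eq_cuspRing {K : Type*} [Field K] (t : K → AlgebraicClosure (RatFunc K))
    (s : K → K) : radicalRing t s = cuspRing 3 t s := by
  have : ∀ x y : AlgebraicClosure (RatFunc K),
      ∑ i ∈ Finset.range 3, x ^ i * y ^ (3 - 1 - i) = x ^ 2 + x * y + y ^ 2 := fun x y => by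
    simp only [Finset.sum_range_succ, Finset.sum_range_zero]
    norm_num
    ring
  simp only [radicalRing, cuspRing, this]

theorem IsCuspData.exists_of_isAlgClosed (K : Type*) [Field K] [IsAlgClosed K] {p n k : ℕ}
    (hn : n.Prime) (hk : k ≠ 0) (hdvd : n ∣ p ^ k - 1) : ∃ t s, IsCuspData (K := K) p n k t s := by
  choose t ht using fun a : K => IsAlgClosed.exists_pow_nat_eq
    ((indet K + algebraMap K (AlgebraicClosure (RatFunc K)) a) ^ p ^ k) hn.pos
  choose s hs using fun b : K => IsAlgClosed.exists_pow_nat_eq (b ^ p ^ k) hn.pos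
  exact ⟨t, s, hn, hk, hdvd, ht, fun b _ => hs b⟩

theorem mainTheorem2 :
    (∀ (K : Type*) [Field K] [IsAlgClosed K] [CharP K 2]
      (t : K → AlgebraicClosure (RatFunc K)) (s : K → K),
      (∀ a : K, t a ^ 3 = (indet K + algebraMap K (AlgebraicClosure (RatFunc K)) a) ^ 4) →
      (∀ b : K, b ≠ 0 → s b ^ 3 = b ^ 4) →
      IsDomain (radicalRing t s) ∧
      IsNoetherianRing (radicalRing t s) ∧
      ringKrullDim (radicalRing t s) = 1 ∧
      IsLocallyFFinite 2 (radicalRing t s) ∧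
      ¬ IsFFinite 2 (radicalRing t s)) ∧
    (∀ (p : ℕ) [Fact p.Prime], ∃ (R : Type) (_ : CommRing R) (_ : CharP R p),
      IsDomain R ∧ IsNoetherianRing R ∧ ringKrullDim R = 1 ∧
      IsLocallyFFinite p R ∧ ¬ IsFFinite p R) := by
  refine ⟨fun K _ _ _ t s ht hs => ?_, fun p hp => ?_⟩
  · have h : IsCuspData 2 3 2 t s := ⟨Nat.prime_three, two_ne_zero, by norm_num, ht, hs⟩
    have key : ∀ R : Subalgebra K (AlgebraicClosure (RatFunc K)), R = cuspRing 3 t s →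
        ∀ [CharP R 2], IsDomain R ∧ IsNoetherianRing R ∧ ringKrullDim R = 1 ∧
          IsLocallyFFinite 2 R ∧ ¬ IsFFinite 2 R := by
      rintro _ rfl _
      exact ⟨inferInstance, h.isNoetherianRing, h.ringKrullDim_eq_one, h.isLocallyFFinite,
        h.not_isFFinite⟩
    exact key _ (radicalRing_eq_cuspRing t s)
  -- `n = 3` divides `2 ^ 2 - 1`, and for odd `p` already `n = 2` divides `p - 1`.
  · obtain ⟨n, k, hn, hk, hdvd⟩ : ∃ n k : ℕ, n.Prime ∧ k ≠ 0 ∧ n ∣ p ^ k - 1 := by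
      rcases hp.out.eq_two_or_odd' with rfl | hodd
      · exact ⟨3, 2, Nat.prime_three, two_ne_zero, by norm_num⟩
      · exact ⟨2, 1, Nat.prime_two, one_ne_zero, by
          rw [pow_one]; exact (Nat.Odd.sub_odd hodd odd_one).two_dvd⟩
    obtain ⟨t, s, h⟩ :=
      IsCuspData.exists_of_isAlgClosed (AlgebraicClosure (ZMod p)) (p := p) hn hk hdvd
    have hchar : CharP (cuspRing n t s) p :=
      charP_of_injective_algebraMap (algebraMap (AlgebraicClosure (ZMod p)) _).injective p
    exact ⟨cuspRing n t s, inferInstance, hchar, inferInstance, h.isNoetherianRing,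
      h.ringKrullDim_eq_one, h.isLocallyFFinite, h.not_isFFinite⟩
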